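/- Let $a$ be a letter. A countable word over $\{a\}$ is a (finite or countably infinite, possibly empty) linear ordering all of whose positions are labelled by $a$; it is scattered if every dense suborder of its domain is empty or a singleton, where a linear ordering is dense if between any two distinct elements there is a third. Monadic second-order logic (MSO) over words has the atomic formulas $x=y$, $x<y$, $a(x)$ and $x\in X$, Boolean connectives, and quantification over positions and over sets of positions; the $\exists$-fragment of MSO consists of the formulas made of a (possibly empty) block of existential set quantifiers followed by a first-order formula (one without set quantifiers). A sentence defines the set of all countable words that satisfy it. Then the language $L_\forall$ of all countable scattered words over the one-letter alphabet $\{a\}$ is definable by a sentence of MSO, but it is not definable by any sentence of the $\exists$-fragment of MSO. -/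

import Mathlib

/-- A linear ordering is scattered if all its dense suborderings are empty or singletons. -/
def IsScattered (α : Type*) [LinearOrder α] : Prop :=
  ∀ s : Set α, DenselyOrdered s → s.Subsingleton

/-- A countable word over the alphabet `A`: a finite or countably infinite (possibly empty)
linear ordering, each position of which is labelled by a letter of `A`.  Every countable linear
ordering is isomorphic to one whose carrier lives in `Type`. -/
structure CountableWord (A : Type) where
  dom : Type
  [linearOrder : LinearOrder dom]
  [countable : Countable dom]
  label : dom → A

attribute [instance] CountableWord.linearOrder CountableWord.countable

/-- The language of all countable words over `A` whose domain is scattered. -/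
def scatteredLanguage (A : Type) : Set (CountableWord A) :=
  {w | IsScattered w.dom}

/-- Formulas of monadic second-order logic over words with letters in `A`, whose free variables
are among `n` first-order variables (ranging over positions) and `m` set variables (ranging over
sets of positions).  Quantifiers bind the variable with index `0`; the other connectives and the
universal quantifiers are abbreviations. -/
inductive MSOFormula (A : Type) : ℕ → ℕ → Type
  | eq {n m : ℕ} (x y : Fin n) : MSOFormula A n m
  | lt {n m : ℕ} (x y : Fin n) : MSOFormula A n m
  | letter {n m : ℕ} (a : A) (x : Fin n) : MSOFormula A n m
  | mem {n m : ℕ} (x : Fin n) (X : Fin m) : MSOFormula A n m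
  | neg {n m : ℕ} (φ : MSOFormula A n m) : MSOFormula A n m
  | and {n m : ℕ} (φ ψ : MSOFormula A n m) : MSOFormula A n m
  | existsPos {n m : ℕ} (φ : MSOFormula A (n + 1) m) : MSOFormula A n m
  | existsSet {n m : ℕ} (φ : MSOFormula A n (m + 1)) : MSOFormula A n m

namespace MSOFormula

variable {A : Type}

/-- Satisfaction of a formula in a word, the free first-order variables being interpreted by `v`
and the free set variables by `V`. -/
def Realize (w : CountableWord A) :
    {n m : ℕ} → MSOFormula A n m → (Fin n → w.dom) → (Fin m → Set w.dom) → Prop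
  | _, _, eq x y, v, _ => v x = v y
  | _, _, lt x y, v, _ => v x < v y
  | _, _, letter a x, v, _ => w.label (v x) = a
  | _, _, mem x X, v, V => v x ∈ V X
  | _, _, neg φ, v, V => ¬ φ.Realize w v V
  | _, _, and φ ψ, v, V => φ.Realize w v V ∧ ψ.Realize w v V
  | _, _, existsPos φ, v, V => ∃ p : w.dom, φ.Realize w (Fin.cons p v) V
  | _, _, existsSet φ, v, V => ∃ P : Set w.dom, φ.Realize w v (Fin.cons P V)

/-- A first-order formula: no set quantifier occurs in it (free set variables are allowed). -/
def IsFirstOrder : {n m : ℕ} → MSOFormula A n m → Prop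
  | _, _, eq _ _ => True
  | _, _, lt _ _ => True
  | _, _, letter _ _ => True
  | _, _, mem _ _ => True
  | _, _, neg φ => φ.IsFirstOrder
  | _, _, and φ ψ => φ.IsFirstOrder ∧ ψ.IsFirstOrder
  | _, _, existsPos φ => φ.IsFirstOrder
  | _, _, existsSet _ => False

/-- The existential fragment of MSO: a (possibly empty) block of existential set quantifiers
followed by a first-order formula. -/
inductive IsExistential : {n m : ℕ} → MSOFormula A n m → Prop
  | firstOrder {n m : ℕ} {φ : MSOFormula A n m} (h : φ.IsFirstOrder) : IsExistential φ
  | existsSet {n m : ℕ} {φ : MSOFormula A n (m + 1)} (h : IsExistential φ) :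
      IsExistential (MSOFormula.existsSet φ)

/-- The language defined by a sentence, i.e. a formula without free variables: the set of all
countable words that satisfy it. -/
def language (φ : MSOFormula A 0 0) : Set (CountableWord A) :=
  {w | φ.Realize w Fin.elim0 Fin.elim0}

end MSOFormula

/-- A language of countable words is MSO-definable if it is defined by some MSO sentence. -/
def IsMSODefinable {A : Type} (L : Set (CountableWord A)) : Prop :=
  ∃ φ : MSOFormula A 0 0, φ.language = L

/-- A language of countable words is definable in the existential fragment of MSO if it is
defined by some MSO sentence of that fragment. -/
def IsExistentialMSODefinable {A : Type} (L : Set (CountableWord A)) : Prop :=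
  ∃ φ : MSOFormula A 0 0, φ.IsExistential ∧ φ.language = L

open Filter

/-! Scatteredness forbids a dense set with two elements, which MSO says directly. For the negative
half, an existential sentence true in `ω` is a first-order statement about `ℕ` with fixed witness
sets, so it transfers to a countable elementary substructure of an ultrapower of `ℕ`
(`exists_skolem_operator`). The substructure is built around the classes of `k ↦ ⌊q * k⌋₊`, `q :
ℚ≥0`, which form a copy of `ℚ≥0` by `eventually_floor_lt_floor`. Hence the sentence also holds in a
non-scattered countable word. -/

theorem isScattered_nat : IsScattered ℕ := by
  intro s hs
  by_contra hn
  rw [Set.not_subsingleton_iff] at hn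
  obtain ⟨a, ha, b, hb, hab⟩ := hn.exists_lt
  have hne : {z : s | (⟨a, ha⟩ : s) < z}.Nonempty := ⟨⟨b, hb⟩, hab⟩
  obtain ⟨c, hac, hmin⟩ := WellFounded.has_min wellFounded_lt _ hne
  obtain ⟨d, had, hdc⟩ := exists_between (show (⟨a, ha⟩ : s) < c from hac)
  exact hmin d had hdc

/-- The range of a strictly monotone map from a nontrivial dense order is a witness against
scatteredness. -/
theorem not_isScattered_of_strictMono {α β : Type*} [LinearOrder α] [LinearOrder β]
    [DenselyOrdered β] [Nontrivial β] {f : β → α} (hf : StrictMono f) : ¬ IsScattered α := by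
  intro h
  have hd : DenselyOrdered (Set.range f) := by
    refine ⟨?_⟩
    rintro ⟨_, x, rfl⟩ ⟨_, y, rfl⟩ hxy
    obtain ⟨z, hxz, hzy⟩ := exists_between (hf.lt_iff_lt.1 (show f x < f y from hxy))
    exact ⟨⟨f z, z, rfl⟩, hf hxz, hf hzy⟩
  obtain ⟨x, y, hxy⟩ := exists_pair_ne β
  exact hxy (hf.injective (h _ hd ⟨x, rfl⟩ ⟨y, rfl⟩))

theorem isMSODefinable_scatteredLanguage (A : Type) :
    IsMSODefinable (scatteredLanguage A) := by
  -- Index `0` is the innermost position: `x, y` are `0, 1`, and become `1, 2` under the quantifier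
  -- for `z`.
  refine ⟨.neg (.existsSet (.and
    (.neg (.existsPos (.existsPos (.and
      (.and (.and (.mem 0 0) (.mem 1 0)) (.lt 0 1))
      (.neg (.existsPos (.and (.mem 0 0) (.and (.lt 1 0) (.lt 0 2)))))))))
    (.existsPos (.existsPos (.and
      (.and (.mem 0 0) (.mem 1 0)) (.neg (.eq 0 1))))))), ?_⟩
  ext w
  change (¬ ∃ P : Set w.dom, (¬ ∃ y x : w.dom, ((x ∈ P ∧ y ∈ P) ∧ x < y) ∧
    ¬ ∃ z : w.dom, z ∈ P ∧ x < z ∧ z < y) ∧ ∃ y x : w.dom, (x ∈ P ∧ y ∈ P) ∧ ¬ x = y) ↔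
    IsScattered w.dom
  constructor
  · intro h s hs x hx y hy
    by_contra hxy
    refine h ⟨s, ?_, y, x, ⟨hx, hy⟩, hxy⟩
    rintro ⟨b, a, ⟨⟨ha, hb⟩, hab⟩, hn⟩
    obtain ⟨c, hac, hcb⟩ := hs.dense ⟨a, ha⟩ ⟨b, hb⟩ hab
    exact hn ⟨c, c.2, hac, hcb⟩
  · rintro h ⟨P, hd, y, x, ⟨hx, hy⟩, hxy⟩
    refine hxy (h P ⟨?_⟩ hx hy)
    rintro ⟨a, ha⟩ ⟨b, hb⟩ hab
    by_contra hn
    refine hd ⟨b, a, ⟨⟨ha, hb⟩, hab⟩, ?_⟩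
    rintro ⟨c, hc, hac, hcb⟩
    exact hn ⟨⟨c, hc⟩, hac, hcb⟩

/-- The word of order type `ω` over the one-letter alphabet. -/
def natWord : CountableWord Unit where
  dom := ℕ
  label _ := ()

/-- The word formed by the elements of the ultrapower of `ℕ` represented by a function in a
countable set `T`. -/
noncomputable def ultraWord (T : Set (ℕ → ℕ)) (hT : T.Countable) : CountableWord Unit where
  dom := ((fun f : ℕ → ℕ => (f : Germ (hyperfilter ℕ : Filter ℕ) ℕ)) '' T : Set _)
  linearOrder := inferInstance
  countable := (hT.image _).to_subtype
  label _ := ()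

/-- The element of `ultraWord T` represented by a function in `T`. -/
noncomputable def ultraWord.mk {T : Set (ℕ → ℕ)} (hT : T.Countable) (f : T) :
    (ultraWord T hT).dom :=
  ⟨((f : ℕ → ℕ) : Germ (hyperfilter ℕ : Filter ℕ) ℕ), f, f.2, rfl⟩

/-- The interpretation in `ultraWord T` of a set of natural numbers. -/
def ultraWord.set {T : Set (ℕ → ℕ)} (hT : T.Countable) (P : Set ℕ) :
    Set (ultraWord T hT).dom :=
  {x | Germ.LiftPred (· ∈ P) x.1}

theorem ultraWord.mk_surjective {T : Set (ℕ → ℕ)} (hT : T.Countable) :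
    Function.Surjective (ultraWord.mk hT) := by
  rintro ⟨_, f, hf, rfl⟩
  exact ⟨⟨f, hf⟩, rfl⟩

theorem ultraWord.mk_lt_mk {T : Set (ℕ → ℕ)} (hT : T.Countable) (f g : T) :
    ultraWord.mk hT f < ultraWord.mk hT g ↔ ∀ᶠ k in (hyperfilter ℕ : Filter ℕ), f.1 k < g.1 k :=
  Germ.coe_lt

theorem ultraWord.mk_eq_mk {T : Set (ℕ → ℕ)} (hT : T.Countable) (f g : T) :
    ultraWord.mk hT f = ultraWord.mk hT g ↔ ∀ᶠ k in (hyperfilter ℕ : Filter ℕ), f.1 k = g.1 k :=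
  Subtype.ext_iff.trans Germ.coe_eq

/-- Łoś's theorem for a first-order formula and a set of functions closed under its Skolem
functions. The operator `F` adds the values of the Skolem functions. -/
theorem exists_skolem_operator {n m : ℕ} (φ : MSOFormula Unit n m) (hφ : φ.IsFirstOrder)
    (V : Fin m → Set ℕ) :
    ∃ F : Set (ℕ → ℕ) → Set (ℕ → ℕ), (∀ S, S.Countable → (F S).Countable) ∧
      ∀ S : ℕ → Set (ℕ → ℕ), Monotone S → (∀ j, F (S j) ⊆ S (j + 1)) →
        ∀ (hT : (⋃ j, S j).Countable) (f : Fin n → (⋃ j, S j : Set (ℕ → ℕ))),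
          φ.Realize (ultraWord _ hT) (fun i => ultraWord.mk hT (f i))
              (fun i => ultraWord.set hT (V i)) ↔
            ∀ᶠ k in (hyperfilter ℕ : Filter ℕ), φ.Realize natWord (fun i => (f i).1 k) V := by
  induction φ with
  | eq x y =>
    exact ⟨fun _ => ∅, fun _ _ => Set.countable_empty, fun S _ _ hT f => ultraWord.mk_eq_mk hT _ _⟩
  | lt x y =>
    exact ⟨fun _ => ∅, fun _ _ => Set.countable_empty, fun S _ _ hT f => ultraWord.mk_lt_mk hT _ _⟩
  | letter a x =>
    exact ⟨fun _ => ∅, fun _ _ => Set.countable_empty, fun S _ _ hT f =>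
      ⟨fun _ => Eventually.of_forall fun _ => rfl, fun _ => rfl⟩⟩
  | mem x X =>
    exact ⟨fun _ => ∅, fun _ _ => Set.countable_empty, fun S _ _ hT f => Iff.rfl⟩
  | neg φ ih =>
    obtain ⟨F, hF, h⟩ := ih hφ V
    refine ⟨F, hF, fun S hS hFS hT f => ?_⟩
    exact (not_congr (h S hS hFS hT f)).trans Ultrafilter.eventually_not.symm
  | and φ ψ ih₁ ih₂ =>
    obtain ⟨F, hF, h⟩ := ih₁ hφ.1 V
    obtain ⟨G, hG, h'⟩ := ih₂ hφ.2 V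
    refine ⟨fun S => F S ∪ G S, fun S hS => (hF S hS).union (hG S hS), fun S hS hFS hT f => ?_⟩
    have h₁ := h S hS (fun j => Set.subset_union_left.trans (hFS j)) hT f
    have h₂ := h' S hS (fun j => Set.subset_union_right.trans (hFS j)) hT f
    exact (and_congr h₁ h₂).trans eventually_and.symm
  | @existsPos n m φ ih =>
    obtain ⟨F, hF, h⟩ := ih hφ V
    classical
    -- A witness is chosen in each coordinate; the default `0` is harmless, since it is only used
    -- off a set of the ultrafilter.
    let sk : (Fin n → ℕ → ℕ) → ℕ → ℕ := fun f k =>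
      if hp : ∃ p : ℕ, φ.Realize natWord (Fin.cons p fun i => f i k) V then hp.choose else 0
    refine ⟨fun S => F S ∪ sk '' {f | ∀ i, f i ∈ S}, fun S hS => (hF S hS).union ?_,
      fun S hS hFS hT f => ?_⟩
    · exact (Set.countable_pi fun _ => hS).image _
    have key : ∀ g : (⋃ j, S j : Set (ℕ → ℕ)),
        φ.Realize (ultraWord _ hT) (Fin.cons (ultraWord.mk hT g) fun i => ultraWord.mk hT (f i))
            (fun i => ultraWord.set hT (V i)) ↔
          ∀ᶠ k in (hyperfilter ℕ : Filter ℕ),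
            φ.Realize natWord (Fin.cons (g.1 k) fun i => (f i).1 k) V := by
      intro g
      have := h S hS (fun j => Set.subset_union_left.trans (hFS j)) hT (Fin.cons g f)
      have e₁ : (fun i => ultraWord.mk hT ((Fin.cons g f : Fin (n + 1) → _) i)) =
          Fin.cons (ultraWord.mk hT g) fun i => ultraWord.mk hT (f i) := by
        funext i
        refine Fin.cases rfl (fun _ => rfl) i
      have e₂ : ∀ k, (fun i => ((Fin.cons g f : Fin (n + 1) → (⋃ j, S j : Set (ℕ → ℕ))) i).1 k) =
          (Fin.cons (g.1 k) fun i => (f i).1 k : Fin (n + 1) → natWord.dom) := by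
        intro k
        funext i
        refine Fin.cases rfl (fun _ => rfl) i
      rw [e₁] at this
      exact this.trans (eventually_congr (Eventually.of_forall fun k =>
        iff_of_eq (congrArg (fun u : Fin (n + 1) → natWord.dom => φ.Realize natWord u V) (e₂ k))))
    constructor
    · rintro ⟨p, hp⟩
      obtain ⟨g, rfl⟩ := ultraWord.mk_surjective hT p
      exact ((key g).1 hp).mono fun k hk => ⟨g.1 k, hk⟩
    · intro hk
      -- The finitely many parameters lie in one stage, so their Skolem value appears in the next.
      have hj : ∃ j, ∀ i, (f i).1 ∈ S j := by
        choose j hj using fun i => Set.mem_iUnion.1 (f i).2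
        exact ⟨Finset.univ.sup j, fun i => hS (Finset.le_sup (Finset.mem_univ i)) (hj i)⟩
      obtain ⟨j, hj⟩ := hj
      have hmem : sk (fun i => (f i).1) ∈ ⋃ j, S j :=
        Set.mem_iUnion.2 ⟨j + 1, hFS j (Or.inr ⟨_, hj, rfl⟩)⟩
      refine ⟨ultraWord.mk hT ⟨_, hmem⟩, (key _).2 (hk.mono fun k hp => ?_)⟩
      have hp' : ∃ p : ℕ, φ.Realize natWord (Fin.cons p fun i => (f i).1 k) V := hp
      change φ.Realize natWord (Fin.cons (sk (fun i => (f i).1) k) fun i => (f i).1 k) V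
      simp only [sk, dif_pos hp']
      exact hp'.choose_spec
  | existsSet φ ih => exact hφ.elim

/-- The gap `(q - p) * k` is at least `1` once `k ≥ (q - p)⁻¹`, which separates the floors. -/
theorem eventually_floor_lt_floor {p q : ℚ≥0} (h : p < q) :
    ∀ᶠ k : ℕ in atTop, ⌊p * k⌋₊ < ⌊q * k⌋₊ := by
  obtain ⟨r, hr, rfl⟩ := exists_pos_add_of_lt' h
  obtain ⟨N, hN⟩ := exists_nat_ge r⁻¹
  filter_upwards [eventually_ge_atTop N] with k hk
  have h1 : 1 ≤ r * k := by
    have : r⁻¹ ≤ k := hN.trans (by exact_mod_cast hk)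
    calc 1 = r * r⁻¹ := (mul_inv_cancel₀ hr.ne').symm
      _ ≤ r * k := by gcongr
  rw [Nat.lt_iff_add_one_le, ← Nat.floor_add_one zero_le, add_mul]
  gcongr

/-- An existential sentence that holds in the word `ω` holds in some non-scattered word. -/
theorem exists_not_isScattered_of_realize_natWord {n m : ℕ} {φ : MSOFormula Unit n m}
    (hφ : φ.IsExistential) (hn : n = 0) (v : Fin n → ℕ) (V : Fin m → Set ℕ)
    (h : φ.Realize natWord v V) :
    ∃ (w : CountableWord Unit) (v' : Fin n → w.dom) (V' : Fin m → Set w.dom),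
      ¬ IsScattered w.dom ∧ φ.Realize w v' V' := by
  induction hφ with
  | @firstOrder m φ hφ =>
    obtain ⟨F, hF, hlos⟩ := exists_skolem_operator φ hφ V
    let fl : ℚ≥0 → ℕ → ℕ := fun q k => ⌊q * k⌋₊
    -- Skolem hull of the floor functions: each stage is countable and adds the Skolem values of the
    -- previous one.
    let S : ℕ → Set (ℕ → ℕ) := fun j => Nat.rec (Set.range fl) (fun _ T => T ∪ F T) j
    have hS : Monotone S := monotone_nat_of_le_succ fun j => Set.subset_union_left
    have hFS : ∀ j, F (S j) ⊆ S (j + 1) := fun j => Set.subset_union_right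
    have hT : (⋃ j, S j).Countable := by
      refine Set.countable_iUnion fun j => ?_
      induction j with
      | zero => exact Set.countable_range fl
      | succ j ih => exact ih.union (hF _ ih)
    subst hn
    refine ⟨ultraWord _ hT, fun i => i.elim0, fun i => ultraWord.set hT (V i), ?_, ?_⟩
    · have hfl : ∀ q, fl q ∈ ⋃ j, S j := fun q => Set.mem_iUnion.2 ⟨0, q, rfl⟩
      refine not_isScattered_of_strictMono (f := fun q => ultraWord.mk hT ⟨fl q, hfl q⟩) ?_
      intro p q hpq
      exact (ultraWord.mk_lt_mk hT _ _).2
        (Nat.hyperfilter_le_atTop (eventually_floor_lt_floor hpq))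
    · have := (hlos S hS hFS hT fun i => i.elim0).2 (Eventually.of_forall fun k => by
        exact (congrArg (fun u : Fin 0 → natWord.dom => φ.Realize natWord u V)
          (funext fun i => i.elim0)).mp h)
      convert this using 1
  | existsSet hφ ih =>
    obtain ⟨P, hP⟩ := h
    obtain ⟨w, v', V', hw, hr⟩ := ih (Fin.cons P V) hP
    -- The new interpretation of the bound set variable witnesses the quantifier.
    refine ⟨w, v', Fin.tail V', hw, V' 0, ?_⟩
    rwa [Fin.cons_self_tail]

theorem mainTheorem6 :
    IsMSODefinable (scatteredLanguage Unit) ∧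
      ¬ IsExistentialMSODefinable (scatteredLanguage Unit) := by
  refine ⟨isMSODefinable_scatteredLanguage Unit, ?_⟩
  rintro ⟨φ, hφ, hL⟩
  have hω : natWord ∈ φ.language := hL ▸ isScattered_nat
  obtain ⟨w, v, V, hw, hr⟩ := exists_not_isScattered_of_realize_natWord hφ rfl _ _ hω
  refine hw (show w ∈ scatteredLanguage Unit from hL ▸ ?_)
  change φ.Realize w Fin.elim0 Fin.elim0
  rwa [Subsingleton.elim v Fin.elim0, Subsingleton.elim V Fin.elim0] at hr
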